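/- \textbf{Setting.} Let $(W,S)$ be a Coxeter system with Coxeter matrix $(m_{st})$ and length function $\ell$. For $I\subseteq S$ let $W_I$ be the subgroup generated by $I$; $I$ is \emph{finitary} if $W_I$ is finite, and then $w_I$ denotes the longest element of $W_I$. For finitary $I,J$, an $(I,J)$-coset is an element $q$ of $W_I\backslash W/W_J$; $\underline q$ and $\overline q$ are its minimal and maximal elements, and $q\le p$ means $\underline q\le\underline p$ in the Bruhat order. Put $\mathrm{LR}(q)=I\cap \underline q J\underline q^{-1}$ and $\mathrm{RR}(q)=\underline q^{-1}I\underline q\cap J$, and let $q^{\mathrm{core}}$ be the $(\mathrm{LR}(q),\mathrm{RR}(q))$-coset containing $\underline q$. A \emph{realization} of $(W,S)$ over a commutative ring $\Bbbk$ is a free $\Bbbk$-module $V$ of finite rank with elements $\alpha_s\in V$ and $\alpha_s^\vee\in V^*=\operatorname{Hom}_\Bbbk(V,\Bbbk)$ $(s\in S)$ such that $\alpha_s^\vee(\alpha_s)=2$, the formula $s(v)=v-\alpha_s^\vee(v)\alpha_s$ defines an action of $W$ on $V$, and $[m_{st}]_{x,y}=0$ for $s\ne t$ with $m_{st}<\infty$,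 where $x=-\alpha_s^\vee(\alpha_t)$, $y=-\alpha_t^\vee(\alpha_s)$, and $[0]_{x,y}=0$, $[1]_{x,y}=1$, $[n+2]_{x,y}=x[n+1]_{y,x}-[n]_{x,y}$. Let $R=\operatorname{Sym}_\Bbbk(V)$ with the induced $W$-action and $R^I=R^{W_I}$. The Demazure operator $\partial_s:R\to R$ is the $\Bbbk$-linear map equal to $\alpha_s^\vee$ on $V$ with $\partial_s(fg)=s(f)\partial_s(g)+\partial_s(f)g$; for $w=s_1\cdots s_n$ reduced, $\partial_w=\partial_{s_1}\cdots\partial_{s_n}$. For an $(I,J)$-coset $q$ put $\partial_q=\partial_{\overline q w_J^{-1}}$, and for $K\subseteq I$ finitary put $\partial^K_I=\partial_{w_Iw_K^{-1}}$. The realization is \emph{Frobenius} if (i) it is balanced: $[m_{st}-1]_{x,y}=1$ for all $s\neq t$ with $m_{st}<\infty$; (ii) it satisfies generalized Demazure surjectivity: all $\alpha_s:V^*\to\Bbbk$ and $\alpha_s^\vee:V\to\Bbbk$ are surjective, and $\partial_{w_I}$ maps $R$ onto $R^I$ for every finitary $I$; (iii) each finite $W_I$ acts faithfully on $V$. Let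 $M\subseteq S$ be finitary, $s\in M$, $t=w_Msw_M$, $I=M\setminus\{s\}$, $J=M\setminus\{t\}$, and let $\mathtt a$ be the $(I,J)$-coset containing $w_M$ (an \emph{atomic} coset). A \emph{rightward atomic Leibniz rule} holds for $\mathtt a$ if there are $R^M$-linear maps $T_q:R^J\to R^{\mathrm{RR}(q)}$, one for each $(I,J)$-coset $q<\mathtt a$, such that for all $f,g\in R^J$ \[\partial_{\mathtt a}(fg)=\underline{\mathtt a}(f)\,\partial_{\mathtt a}(g)+\sum_{q<\mathtt a}\partial_{\overline q w_J^{-1}}\bigl(T_q(f)\,g\bigr).\] A \emph{leftward atomic Leibniz rule} holds for $\mathtt a$ if there are $R^M$-linear maps $T'_q:R^J\to R^{\mathrm{LR}(q)}$, $q<\mathtt a$, such that for all $f,g\in R^J$ \[\partial_{\mathtt a}(fg)=\underline{\mathtt a}(f)\,\partial_{\mathtt a}(g)+\sum_{q<\mathtt a}\partial^{\mathrm{LR}(q)}_I\bigl(T'_q(f)\,\partial_{q^{\mathrm{core}}}(g)\bigr).\] From a realization $(V,\alpha,\alpha^\vee)$ one obtains new realizations of $(W,S)$: its \emph{specializations}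 $V\otimes_\Bbbk\Bbbk'$, for a commutative $\Bbbk$-algebra $\Bbbk'$, with roots $\alpha_s\otimes1$ and the $\Bbbk'$-linear extensions of the coroots; its \emph{$W$-invariant enlargements} $V\oplus N$, for a free $\Bbbk$-module $N$ of finite rank, with roots $(\alpha_s,0)$ and coroots extended by $0$ on $N$; and its \emph{$W$-invariant quotients} $Y\cong V/X$, for a decomposition $V=X\oplus Y$ into free $\Bbbk$-modules such that $W$ acts trivially on $X$ and such that the image $\overline{\alpha}_s$ of each $\alpha_s$ in $Y$ induces a surjection $Y^*\to\Bbbk$, with roots $\overline{\alpha}_s$ and the induced coroots (the old coroots vanish on $X$). \textbf{Lemma.} Let $V$ be a Frobenius realization of $(W,S)$ and let $\mathtt a$ be an atomic coset. If a rightward (resp. leftward) atomic Leibniz rule holds for $\mathtt a$ and $V$, then a rightward (resp. leftward) atomic Leibniz rule holds for $\mathtt a$ and every specialization, every $W$-invariant enlargement and every $W$-invariant quotient of $V$. -/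

import Mathlib

open scoped TensorProduct

universe uB uW uk uV uk' uN

noncomputable section

namespace AtomicLeibniz

/-! ### Coxeter systems: parabolic subgroups, Bruhat order, double cosets -/

section Coxeter

variable {B : Type uB} {W : Type uW} [Group W] {m : CoxeterMatrix B} (cs : CoxeterSystem m W)

/-- The parabolic subgroup `W_I` generated by the simple reflections in `I`. -/
def parabolic (I : Set B) : Subgroup W := Subgroup.closure (cs.simple '' I)

/-- `I` is finitary if `W_I` is a finite group. -/
def Finitary (I : Set B) : Prop := Finite (parabolic cs I)

/-- An element of minimal length in a set `A` of elements of `W`. -/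
def shortest (A : Set W) : W :=
  Classical.epsilon fun w => w ∈ A ∧ ∀ v ∈ A, cs.length w ≤ cs.length v

/-- An element of maximal length in a (finite nonempty) set `A` of elements of `W`. -/
def longest (A : Set W) : W :=
  Classical.epsilon fun w => w ∈ A ∧ ∀ v ∈ A, cs.length v ≤ cs.length w

theorem shortest_spec {A : Set W} (hA : A.Nonempty) :
    shortest cs A ∈ A ∧ ∀ v ∈ A, cs.length (shortest cs A) ≤ cs.length v := by
  refine Classical.epsilon_spec (p := fun w => w ∈ A ∧ ∀ v ∈ A, cs.length w ≤ cs.length v) ?_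
  obtain ⟨w, hw, h⟩ := exists_minimalFor_of_wellFoundedLT (· ∈ A) cs.length hA
  refine ⟨w, hw, fun v hv => ?_⟩
  rcases le_total (cs.length w) (cs.length v) with h' | h'
  · exact h'
  · exact h hv h'

theorem longest_spec {A : Set W} (hA : A.Nonempty) (hfin : A.Finite) :
    longest cs A ∈ A ∧ ∀ v ∈ A, cs.length v ≤ cs.length (longest cs A) :=
  Classical.epsilon_spec (p := fun w => w ∈ A ∧ ∀ v ∈ A, cs.length v ≤ cs.length w)
    (Set.exists_max_image A cs.length hfin hA)

/-- The longest element `w_I` of the parabolic subgroup `W_I` (for finitary `I`). -/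
def longestElement (I : Set B) : W := longest cs (parabolic cs I : Set W)

/-- The Bruhat order, through the subword property: `u ≤ w` if every reduced word for `w` contains
a reduced word for `u` as a subword. -/
def BruhatLE (u w : W) : Prop :=
  ∀ ω : List B, cs.IsReduced ω → cs.wordProd ω = w →
    ∃ ω' : List B, ω'.Sublist ω ∧ cs.IsReduced ω' ∧ cs.wordProd ω' = u

/-- An `(I,J)`-coset: an element of `W_I \ W / W_J`. -/
abbrev Coset (I J : Set B) : Type uW :=
  DoubleCoset.Quotient (parabolic cs I : Set W) (parabolic cs J : Set W)

/-- The `(I,J)`-coset `W_I w W_J` containing `w`. -/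
abbrev Coset.of (I J : Set B) (w : W) : Coset cs I J :=
  DoubleCoset.mk (parabolic cs I) (parabolic cs J) w

variable {cs} {I J : Set B}

/-- The underlying subset of `W` of an `(I,J)`-coset. -/
def Coset.toSet (q : Coset cs I J) : Set W := {w | Coset.of cs I J w = q}

/-- The minimal element of an `(I,J)`-coset. -/
def Coset.min (q : Coset cs I J) : W := shortest cs q.toSet

/-- The maximal element of an `(I,J)`-coset (for finitary `I` and `J`). -/
def Coset.max (q : Coset cs I J) : W := longest cs q.toSet

/-- The left redundancy `I ∩ q J q⁻¹`, where `q` stands for the minimal element of the coset. -/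
def Coset.leftRed (q : Coset cs I J) : Set B :=
  {i | i ∈ I ∧ ∃ j ∈ J, cs.simple i = q.min * cs.simple j * q.min⁻¹}

/-- The right redundancy `q⁻¹ I q ∩ J`, where `q` stands for the minimal element of the coset. -/
def Coset.rightRed (q : Coset cs I J) : Set B :=
  {j | j ∈ J ∧ ∃ i ∈ I, cs.simple j = q.min⁻¹ * cs.simple i * q.min}

/-- The core of an `(I,J)`-coset `q`: the `(leftRed q, rightRed q)`-coset with the same minimal
element. -/
def Coset.core (q : Coset cs I J) : Coset cs q.leftRed q.rightRed :=
  Coset.of cs q.leftRed q.rightRed q.min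

/-- The strict Bruhat order on `(I,J)`-cosets: comparison of the minimal elements. -/
def Coset.Lt (q p : Coset cs I J) : Prop := BruhatLE cs q.min p.min ∧ q ≠ p

theorem Coset.of_min (q : Coset cs I J) : Coset.of cs I J q.min = q := by
  have h : (q.toSet).Nonempty := ⟨q.out, DoubleCoset.out_eq' _ _ q⟩
  exact (shortest_spec cs h).1

theorem finite_bruhatLE (w : W) : {u | BruhatLE cs u w}.Finite := by
  obtain ⟨ω, hω, rfl⟩ := cs.exists_isReduced w
  refine Set.Finite.subset (s := cs.wordProd '' {ω' | ω' ∈ ω.sublists}) ?_ ?_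
  · exact (List.finite_toSet _).image _
  · intro u hu
    obtain ⟨ω', h, -, rfl⟩ := hu ω hω rfl
    exact ⟨ω', by simpa using h, rfl⟩

/-- There are only finitely many cosets below a given one. -/
instance Coset.finite_lt (p : Coset cs I J) : Finite {q : Coset cs I J // q.Lt p} := by
  have := (finite_bruhatLE (cs := cs) p.min).to_subtype
  refine Finite.of_injective
    (fun q : {q : Coset cs I J // q.Lt p} =>
      (⟨q.1.min, q.2.1⟩ : {u | BruhatLE cs u p.min})) ?_
  intro q q' h
  have h' : q.1.min = q'.1.min := congrArg Subtype.val h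
  apply Subtype.ext
  rw [← Coset.of_min q.1, ← Coset.of_min q'.1, h']

end Coxeter

section Atomic

variable {B : Type uB} {W : Type uW} [Group W] {m : CoxeterMatrix B} (cs : CoxeterSystem m W)

/-- The data of an atomic coset: a finitary subset `M`, an element `s` of `M` and the element
`t = w_M s w_M` of `M`. -/
structure AtomicDatum where
  M : Set B
  finitary : Finitary cs M
  s : B
  t : B
  s_mem : s ∈ M
  t_mem : t ∈ M
  conj : cs.simple t = longestElement cs M * cs.simple s * longestElement cs M

variable {cs}

/-- `I = M \ s`. -/
def AtomicDatum.I (d : AtomicDatum cs) : Set B := d.M \ {d.s}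

/-- `J = M \ t`. -/
def AtomicDatum.J (d : AtomicDatum cs) : Set B := d.M \ {d.t}

/-- The atomic coset: the `(I,J)`-coset containing `w_M`. -/
def AtomicDatum.coset (d : AtomicDatum cs) : Coset cs d.I d.J :=
  Coset.of cs d.I d.J (longestElement cs d.M)

theorem AtomicDatum.J_subset (d : AtomicDatum cs) : d.J ⊆ d.M := Set.sdiff_subset

theorem AtomicDatum.rightRed_subset (d : AtomicDatum cs) (q : Coset cs d.I d.J) :
    q.rightRed ⊆ d.M := fun _ hj => hj.1.1

theorem AtomicDatum.leftRed_subset (d : AtomicDatum cs) (q : Coset cs d.I d.J) :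
    q.leftRed ⊆ d.M := fun _ hi => hi.1.1

end Atomic

/-! ### Realizations -/

/-- Two-coloured quantum numbers: `[0]_x = 0`, `[1]_x = 1`, `[n+2]_x = x [n+1]_y - [n]_x`, where
`[n]_y` is `[n]_x` with `x` and `y` exchanged. -/
def quantumNumber {k : Type uk} [CommRing k] : ℕ → k → k → k
  | 0, _, _ => 0
  | 1, _, _ => 1
  | n + 2, x, y => x * quantumNumber (n + 1) y x - quantumNumber n x y

theorem map_quantumNumber {k : Type uk} {k' : Type uk'} [CommRing k] [CommRing k'] (φ : k →+* k')
    (n : ℕ) (x y : k) : φ (quantumNumber n x y) = quantumNumber n (φ x) (φ y) := by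
  induction n using Nat.strong_induction_on generalizing x y with
  | _ n ih =>
    match n with
    | 0 => simp [quantumNumber]
    | 1 => simp [quantumNumber]
    | n + 2 => simp [quantumNumber, ih (n + 1) (by omega), ih n (by omega)]

/-- The map `v ↦ v - f(v) a`. -/
def reflectionMap {k : Type uk} {V : Type uV} [CommRing k] [AddCommGroup V] [Module k V]
    (a : V) (f : Module.Dual k V) : Module.End k V := LinearMap.id - f.smulRight a

theorem reflectionMap_apply {k : Type uk} {V : Type uV} [CommRing k] [AddCommGroup V] [Module k V]
    (a : V) (f : Module.Dual k V) (v : V) : reflectionMap a f v = v - f v • a := by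
  simp [reflectionMap]

section Realization

/-- A realization of a Coxeter system `(W,S)` over `k`. The entries `m s t = ∞` of the Coxeter
matrix are encoded by `m s t = 0`; for those the last condition is void. -/
structure Realization {B : Type uB} {W : Type uW} [Group W] {m : CoxeterMatrix B}
    (cs : CoxeterSystem m W) (k : Type uk) (V : Type uV) [CommRing k] [AddCommGroup V]
    [Module k V] where
  free : Module.Free k V
  finite : Module.Finite k V
  root : B → V
  coroot : B → Module.Dual k V
  coroot_root : ∀ s, coroot s (root s) = 2
  /-- The reflections satisfy the Coxeter relations, hence define an action of `W` on `V`. -/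
  liftable : m.IsLiftable fun s => reflectionMap (root s) (coroot s)
  technical : ∀ s t, s ≠ t → quantumNumber (m s t) (-coroot s (root t)) (-coroot t (root s)) = 0

variable {B : Type uB} {W : Type uW} [Group W] {m : CoxeterMatrix B} {cs : CoxeterSystem m W}
variable {k : Type uk} {V : Type uV} [CommRing k] [AddCommGroup V] [Module k V]

namespace Realization

variable (R : Realization cs k V)

/-- The action of `W` on `V`. -/
def rep : W →* Module.End k V :=
  cs.lift ⟨fun s => reflectionMap (R.root s) (R.coroot s), R.liftable⟩

theorem rep_simple (s : B) : R.rep (cs.simple s) = reflectionMap (R.root s) (R.coroot s) :=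
  cs.lift_apply_simple R.liftable s

/-- The polynomial ring whose linear terms are `V`. -/
abbrev Poly (_R : Realization cs k V) : Type (max uk uV) := SymmetricAlgebra k V

/-- The action of `w ∈ W` on the polynomial ring by algebra endomorphisms. -/
def act (w : W) : R.Poly →ₐ[k] R.Poly :=
  SymmetricAlgebra.lift (SymmetricAlgebra.ι k V ∘ₗ R.rep w)

/-- The subring `R^I` of `W_I`-invariants. -/
def invariants (I : Set B) : Subalgebra k R.Poly where
  carrier := {f | ∀ w ∈ parabolic cs I, R.act w f = f}
  mul_mem' ha hb w hw := by rw [map_mul, ha w hw, hb w hw]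
  add_mem' ha hb w hw := by rw [map_add, ha w hw, hb w hw]
  algebraMap_mem' r w _ := (R.act w).commutes r

/-- For `I ⊆ M`, the ring `R^I` as a module over `R^M`. -/
def invariantsOver {I M : Set B} (h : I ⊆ M) : Submodule (R.invariants M) R.Poly where
  carrier := R.invariants I
  add_mem' := add_mem
  zero_mem' := zero_mem _
  smul_mem' c x hx := by
    have hc : (c : R.Poly) ∈ R.invariants I := fun w hw =>
      c.2 w (Subgroup.closure_mono (Set.image_mono h) hw)
    exact mul_mem hc hx

/-- The substitution `v ↦ v + α_s^∨(v) T` from the polynomial ring `R` to `R[T]`. -/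
def shift (s : B) : R.Poly →ₐ[k] Polynomial R.Poly :=
  SymmetricAlgebra.lift
    ((Polynomial.CAlgHom (R := k) (A := R.Poly)).toLinearMap ∘ₗ SymmetricAlgebra.ι k V
      + (R.coroot s).smulRight (Polynomial.X : Polynomial R.Poly))

/-- The Demazure operator `∂_s`, as the divided difference `(f - s f) / α_s`. Writing `F(T)` for
the image of `f` under `v ↦ v + α_s^∨(v) T`, one has `F(0) = f` and `F(-α_s) = s f`, and `∂_s f` is
the value at `T = -α_s` of the polynomial `(F(T) - F(0)) / T`. It is the `k`-linear operator
which is `α_s^∨` on `V` and obeys the twisted Leibniz rule: see `demazureSimple_ι` and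
`demazureSimple_mul`. -/
def demazureSimple (s : B) : Module.End k R.Poly where
  toFun f := ((R.shift s f).divX).eval (-SymmetricAlgebra.ι k V (R.root s))
  map_add' f g := by simp [Polynomial.divX_add]
  map_smul' c f := by
    have h : (c • R.shift s f).divX = c • (R.shift s f).divX := by
      ext n; simp [Polynomial.coeff_divX]
    simp [h, Polynomial.eval_smul]

theorem shift_ι (s : B) (v : V) : R.shift s (SymmetricAlgebra.ι k V v) =
    Polynomial.C (SymmetricAlgebra.ι k V v) + R.coroot s v • Polynomial.X := by
  simp [shift]

theorem demazureSimple_ι (s : B) (v : V) :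
    R.demazureSimple s (SymmetricAlgebra.ι k V v) = algebraMap k R.Poly (R.coroot s v) := by
  have h : (R.shift s (SymmetricAlgebra.ι k V v)).divX
      = Polynomial.C (algebraMap k R.Poly (R.coroot s v)) := by
    ext n
    rw [Polynomial.coeff_divX, shift_ι]
    rcases n with _ | n <;> simp [Polynomial.coeff_C, Algebra.smul_def]
  simp [demazureSimple, h]

theorem shift_coeff_zero (s : B) (f : R.Poly) : (R.shift s f).coeff 0 = f := by
  have h : ((Polynomial.aeval (0 : R.Poly)).restrictScalars k).comp (R.shift s)
      = AlgHom.id k R.Poly := by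
    apply SymmetricAlgebra.algHom_ext
    ext v
    simp [shift_ι]
  have := DFunLike.congr_fun h f
  simpa [Polynomial.coeff_zero_eq_eval_zero, Polynomial.aeval_def] using this

theorem shift_eval (s : B) (f : R.Poly) :
    (R.shift s f).eval (-SymmetricAlgebra.ι k V (R.root s)) = R.act (cs.simple s) f := by
  have h : ((Polynomial.aeval (-SymmetricAlgebra.ι k V (R.root s))).restrictScalars k).comp
      (R.shift s) = R.act (cs.simple s) := by
    apply SymmetricAlgebra.algHom_ext
    ext v
    simp [shift_ι, act, rep_simple, reflectionMap_apply, sub_eq_add_neg]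
  have := DFunLike.congr_fun h f
  simpa [Polynomial.aeval_def] using this

/-- `α_s ∂_s(f) = f - s(f)`. -/
theorem root_mul_demazureSimple (s : B) (f : R.Poly) :
    SymmetricAlgebra.ι k V (R.root s) * R.demazureSimple s f = f - R.act (cs.simple s) f := by
  have h := congrArg (Polynomial.eval (-SymmetricAlgebra.ι k V (R.root s)))
    (Polynomial.divX_mul_X_add (R.shift s f))
  simp only [Polynomial.eval_add, Polynomial.eval_mul, Polynomial.eval_X, Polynomial.eval_C,
    shift_coeff_zero, shift_eval] at h
  simp only [demazureSimple, LinearMap.coe_mk, AddHom.coe_mk]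
  rw [← h]; ring

/-- The twisted Leibniz rule `∂_s(fg) = s(f) ∂_s(g) + ∂_s(f) g`. -/
theorem demazureSimple_mul (s : B) (f g : R.Poly) : R.demazureSimple s (f * g) =
    R.act (cs.simple s) f * R.demazureSimple s g + R.demazureSimple s f * g := by
  have h : (R.shift s (f * g)).divX
      = R.shift s f * (R.shift s g).divX + (R.shift s f).divX * Polynomial.C g := by
    have hX : ∀ p q : Polynomial R.Poly, Polynomial.X * p = Polynomial.X * q → p = q := by
      intro p q hpq
      ext n
      simpa using congrArg (fun r => Polynomial.coeff r (n + 1)) hpq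
    apply hX
    have e := fun f : R.Poly => Polynomial.X_mul_divX_add (R.shift s f)
    simp only [shift_coeff_zero] at e
    have e0 := e (f * g)
    rw [map_mul, map_mul] at e0
    rw [map_mul]
    linear_combination e0 - R.shift s f * e g - Polynomial.C g * e f
  simp only [demazureSimple, LinearMap.coe_mk, AddHom.coe_mk, h, Polynomial.eval_add,
    Polynomial.eval_mul, Polynomial.eval_C, shift_eval]

/-- A reduced word for `w`, chosen once and for all, independently of the realization. -/
def reducedWord (cs : CoxeterSystem m W) (w : W) : List B :=
  Classical.choose (cs.exists_isReduced w)

/-- The Demazure operator `∂_w`, the composition of the operators `∂_s` along a reduced word for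
`w`. For a balanced realization the Demazure operators satisfy the braid relations, so the choice
of the reduced word does not matter. -/
def demazure (w : W) : Module.End k R.Poly :=
  ((reducedWord cs w).map R.demazureSimple).prod

/-- The Demazure operator `∂_q = ∂_{max(q) w_J⁻¹}` of an `(I,J)`-coset, as an operator on the whole
polynomial ring. -/
def demazureCoset {I J : Set B} (q : Coset cs I J) : Module.End k R.Poly :=
  R.demazure (q.max * (longestElement cs J)⁻¹)

/-- The Frobenius trace `∂^K_I : R^K → R^I` for `K ⊆ I`: the Demazure operator of the `(I,K)`-coset
`W_I`, whose maximal element is `w_I`. -/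
def frobeniusTrace (K I : Set B) : Module.End k R.Poly :=
  R.demazureCoset (Coset.of cs I K 1)

/-- A realization is balanced if the quantum numbers `[m_st - 1]` equal `1`. -/
def Balanced : Prop :=
  ∀ s t, s ≠ t → m s t ≠ 0 →
    quantumNumber (m s t - 1) (-R.coroot s (R.root t)) (-R.coroot t (R.root s)) = 1

/-- Generalized Demazure surjectivity: `α_s : V* → k` and `α_s^∨ : V → k` are surjective, and for
each finitary `I` the operator `∂_{w_I}` maps `R` onto `R^I`. -/
structure GeneralizedDemazureSurjective : Prop where
  root_surjective : ∀ s, Function.Surjective fun φ : Module.Dual k V => φ (R.root s)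
  coroot_surjective : ∀ s, Function.Surjective (R.coroot s)
  onto : ∀ I, Finitary cs I →
    Set.range (R.demazure (longestElement cs I)) = (R.invariants I : Set R.Poly)

/-- A (balanced) Frobenius realization. -/
structure IsFrobenius : Prop where
  balanced : R.Balanced
  surjective : R.GeneralizedDemazureSurjective
  faithful : ∀ I, Finitary cs I → ∀ w ∈ parabolic cs I, R.rep w = 1 → w = 1

/-- The rightward atomic Leibniz rule for the atomic coset of the datum `d`. -/
def RightwardRule (d : AtomicDatum cs) : Prop :=
  ∃ T : ∀ q : {q : Coset cs d.I d.J // q.Lt d.coset},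
      R.invariantsOver d.J_subset →ₗ[R.invariants d.M] R.invariantsOver (d.rightRed_subset q.1),
    ∀ f g : R.invariantsOver d.J_subset,
      R.demazureCoset d.coset (f * g : R.Poly) =
        R.act d.coset.min (f : R.Poly) * R.demazureCoset d.coset (g : R.Poly) +
          ∑ᶠ q, R.demazure (q.1.max * (longestElement cs d.J)⁻¹) ((T q f : R.Poly) * (g : R.Poly))

/-- The leftward atomic Leibniz rule for the atomic coset of the datum `d`. -/
def LeftwardRule (d : AtomicDatum cs) : Prop :=
  ∃ T : ∀ q : {q : Coset cs d.I d.J // q.Lt d.coset},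
      R.invariantsOver d.J_subset →ₗ[R.invariants d.M] R.invariantsOver (d.leftRed_subset q.1),
    ∀ f g : R.invariantsOver d.J_subset,
      R.demazureCoset d.coset (f * g : R.Poly) =
        R.act d.coset.min (f : R.Poly) * R.demazureCoset d.coset (g : R.Poly) +
          ∑ᶠ q, R.frobeniusTrace q.1.leftRed d.I
            ((T q f : R.Poly) * R.demazureCoset q.1.core (g : R.Poly))

/-! ### Changing the realization -/

/-- The Coxeter relations pass along a surjective map that intertwines two families of
endomorphisms. -/
theorem liftable_of_comp {V' : Type*} [AddCommGroup V'] [Module k V']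
    {r : B → Module.End k V} {r' : B → Module.End k V'} (p : V →ₗ[k] V')
    (hp : Function.Surjective p) (h : ∀ s v, p (r s v) = r' s (p v)) (hr : m.IsLiftable r) :
    m.IsLiftable r' := by
  intro i j
  have key : ∀ n v, p (((r i * r j) ^ n) v) = ((r' i * r' j) ^ n) (p v) := by
    intro n
    induction n with
    | zero => simp
    | succ n ih => intro v; simp [pow_succ, ih, h]
  ext v'
  obtain ⟨v, rfl⟩ := hp v'
  rw [← key, hr i j]
  simp

/-- The specialization (base change) along `k → k'`. The new coroots are the `k'`-linear
extensions of the old ones. -/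
def specialization (k' : Type uk') [CommRing k'] [Algebra k k'] :
    Realization cs k' (k' ⊗[k] V) where
  free := by have := R.free; infer_instance
  finite := by have := R.finite; infer_instance
  root s := 1 ⊗ₜ R.root s
  coroot s := (R.coroot s).baseChange k'
  coroot_root s := by simp [R.coroot_root, Algebra.smul_def, map_ofNat]
  liftable := by
    have h : ∀ s, reflectionMap (k := k') (V := k' ⊗[k] V) (1 ⊗ₜ R.root s)
        ((R.coroot s).baseChange k')
        = (reflectionMap (R.root s) (R.coroot s)).baseChange k' := by
      intro s
      ext v
      simp [reflectionMap_apply, TensorProduct.tmul_sub, TensorProduct.smul_tmul']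
    intro i j
    simp only [h]
    rw [← LinearMap.baseChange_mul, ← LinearMap.baseChange_pow, R.liftable i j,
      LinearMap.baseChange_one]
  technical s t hst := by
    have h := congrArg (algebraMap k k') (R.technical s t hst)
    rw [map_quantumNumber] at h
    simpa [Algebra.smul_def] using h

/-- The `W`-invariant enlargement by a free module `N` of finite rank with trivial action. -/
def enlargement (N : Type uN) [AddCommGroup N] [Module k N] [Module.Free k N]
    [Module.Finite k N] : Realization cs k (V × N) where
  free := by have := R.free; infer_instance
  finite := by have := R.finite; infer_instance
  root s := (R.root s, 0)
  coroot s := R.coroot s ∘ₗ LinearMap.fst k V N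
  coroot_root s := by simp [R.coroot_root]
  liftable := by
    have h : ∀ s, reflectionMap (k := k) (V := V × N) (R.root s, 0)
        (R.coroot s ∘ₗ LinearMap.fst k V N)
        = (reflectionMap (R.root s) (R.coroot s)).prodMap LinearMap.id := by
      intro s
      ext v <;> simp [reflectionMap_apply]
    intro i j
    simp only [h]
    have key : ∀ n : ℕ, ((reflectionMap (R.root i) (R.coroot i)).prodMap
        (LinearMap.id : N →ₗ[k] N) * (reflectionMap (R.root j) (R.coroot j)).prodMap
        LinearMap.id : Module.End k (V × N)) ^ n =
        LinearMap.prodMap ((reflectionMap (R.root i) (R.coroot i) *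
          reflectionMap (R.root j) (R.coroot j)) ^ n) LinearMap.id := by
      intro n
      induction n with
      | zero => ext v <;> simp
      | succ n ih => rw [pow_succ, ih]; ext v <;> simp [pow_succ]
    rw [key, R.liftable i j]
    ext v <;> simp
  technical s t hst := by simpa using R.technical s t hst

/-- The data for a `W`-invariant quotient: a decomposition `V = X ⊕ Y` into free modules, such that
`W` acts trivially on `X`, and such that the image of each `α_s` in `Y ≅ V / X` induces a surjection
`Y* → k`. -/
structure QuotientDatum where
  X : Submodule k V
  Y : Submodule k V
  isCompl : IsCompl X Y
  freeX : Module.Free k X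
  freeY : Module.Free k Y
  trivial : ∀ w : W, ∀ x ∈ X, R.rep w x = x
  surjective : ∀ s : B, Function.Surjective fun φ : Module.Dual k Y =>
    φ (Y.projectionOnto X isCompl.symm (R.root s))

variable {R}

/-- The projection `V → Y` along `X`. -/
def QuotientDatum.proj (D : R.QuotientDatum) : V →ₗ[k] D.Y :=
  D.Y.projectionOnto D.X D.isCompl.symm

theorem QuotientDatum.coroot_eq_zero (D : R.QuotientDatum) (s : B) {x : V} (hx : x ∈ D.X) :
    R.coroot s x = 0 := by
  have h := D.trivial (cs.simple s) x hx
  rw [rep_simple, reflectionMap_apply, sub_eq_self] at h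
  obtain ⟨φ, hφ⟩ := D.surjective s 1
  have h' := congrArg (fun v => φ (D.proj v)) h
  simp only [map_smul, map_zero, smul_eq_mul] at h'
  have hφ' : φ (D.proj (R.root s)) = 1 := hφ
  rwa [hφ', mul_one] at h'

theorem QuotientDatum.coroot_proj (D : R.QuotientDatum) (s : B) (v : V) :
    R.coroot s (D.proj v : V) = R.coroot s v := by
  have h : v - (D.proj v : V) ∈ D.X := by
    have : D.proj (v - (D.proj v : V)) = 0 := by
      rw [map_sub, sub_eq_zero]
      exact (Submodule.projectionOnto_apply_left D.isCompl.symm (D.proj v)).symm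
    exact (Submodule.projectionOnto_apply_eq_zero_iff D.isCompl.symm).1 this
  have := D.coroot_eq_zero s h
  rw [map_sub, sub_eq_zero] at this
  exact this.symm

/-- The `W`-invariant quotient `Y ≅ V / X`: the roots are the images of the old roots under the
projection along `X`, and the coroots are those induced by the old ones, which kill `X`. -/
def quotient (D : R.QuotientDatum) : Realization cs k D.Y where
  free := D.freeY
  finite := by
    have := R.finite
    exact Module.Finite.of_surjective D.proj
      (Submodule.projectionOnto_surjective D.isCompl.symm)
  root s := D.proj (R.root s)
  coroot s := R.coroot s ∘ₗ D.Y.subtype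
  coroot_root s := by simpa [D.coroot_proj] using R.coroot_root s
  liftable := by
    refine liftable_of_comp D.proj (Submodule.projectionOnto_surjective D.isCompl.symm) ?_
      R.liftable
    intro s v
    simp [reflectionMap_apply, D.coroot_proj]
  technical s t hst := by simpa [D.coroot_proj] using R.technical s t hst

end Realization

end Realization

end AtomicLeibniz

end

-- All three constructions are extensions of scalars. There is a ring map `φ : R → R'` compatible
-- with roots and simple reflections, and a subring `A` of `W`-invariants of `R'`, such that the
-- products `a * φ f` span `R'` additively. Here `A` is `k'`, `Sym(N)` or `k` (strictly, its image
-- in `R'`): `Sym(k' ⊗ V) ≅ k' ⊗ Sym(V)`, `Sym(V ⊕ N) ≅ Sym(N) ⊗ Sym(V)`, and `Sym(Y)` is the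
-- quotient of `Sym(V)` by the ideal generated by `X`.
--
-- Every Demazure operator of `R'` is the `A`-linear extension of that of `R`, because `α_s ∂_s(f) =
-- f - s(f)` and unimodular roots are regular. If `∂_{w_J}(P) = 1`, an invariant `x` of `R'` equals
-- `∂_{w_J}(x φ(P))`, so `R'^J` is spanned by the products `a * φ f` with `f ∈ R^J`. This needs
-- `∂_{w_J}` to be `R'^J`-linear, hence the letters of a reduced word of `w_J` to act trivially on
-- `R'^J`; the study of inversions supplies this.
--
-- The maps `T_q` transfer by precomposing with the retraction `f ↦ ∂_{w_J}(f P)` of `R` onto `R^J`,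
-- extending the resulting `R^M`-linear endomorphism of `R`, and restricting to `R'^J`. For
-- quotients the extension is well defined because `X ⊆ R^M`. Both sides of the Leibniz rule are
-- biadditive, so it is enough to compare them on `a * φ f` and `b * φ g`, where the rule for `R`
-- applies.

universe uV'

noncomputable section

namespace AtomicLeibniz

/-! ### Inversion sequences and reduced words in parabolic subgroups. -/

section Inversions

variable {B : Type uB} {W : Type uW} [Group W] {m : CoxeterMatrix B} (cs : CoxeterSystem m W)

open Classical in
/-- The signed conjugation by a simple reflection: `(t, ε) ↦ (s t s, ε + δ_{s,t})`. -/
def signedConj (i : B) : Function.End (W × ZMod 2) := fun p =>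
  (cs.simple i * p.1 * cs.simple i, p.2 + if p.1 = cs.simple i then 1 else 0)

-- The letter `i` put in front of `ω` flips the sign exactly when the conjugated first coordinate is
-- `s_i`, that is, when `p.1` is the entry which `i` adds to the right inversion sequence.
open Classical in
theorem prod_map_signedConj (ω : List B) (p : W × ZMod 2) :
    (ω.map (signedConj cs)).prod p =
      (cs.wordProd ω * p.1 * (cs.wordProd ω)⁻¹, p.2 + ((cs.rightInvSeq ω).count p.1 : ZMod 2)) := by
  induction ω with
  | nil => simp [Function.End.one_def]
  | cons i ω ih =>
    have hcons : ((i :: ω).map (signedConj cs)).prod p =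
        signedConj cs i ((ω.map (signedConj cs)).prod p) := by
      rw [List.map_cons, List.prod_cons]; rfl
    rw [hcons, ih]
    have h : cs.wordProd ω * p.1 * (cs.wordProd ω)⁻¹ = cs.simple i ↔
        (cs.wordProd ω)⁻¹ * cs.simple i * cs.wordProd ω = p.1 := by
      constructor
      · intro h; rw [← h]; group
      · intro h; rw [← h]; group
    refine Prod.ext ?_ ?_
    · simp [signedConj, cs.wordProd_cons, mul_assoc]
    · simp only [signedConj, CoxeterSystem.rightInvSeq, List.count_cons, beq_iff_eq, h]
      split_ifs <;> simp [add_assoc]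

theorem prod_map_alternatingWord {G : Type*} [Monoid G] (f : B → G) (i j : B) (p : ℕ) :
    ((CoxeterSystem.alternatingWord i j (2 * p)).map f).prod = (f i * f j) ^ p := by
  induction p with
  | zero => simp [CoxeterSystem.alternatingWord]
  | succ p ih =>
    rw [mul_add, mul_one, CoxeterSystem.alternatingWord, CoxeterSystem.alternatingWord]
    simp [ih, pow_succ]

/-- The alternating word of length `2 m_ij` has product `1`, and its inversion sequence runs twice
through the same `m_ij` reflections. Every reflection thus occurs an even number of times and no
sign changes. -/
theorem signedConj_isLiftable : m.IsLiftable (signedConj cs) := by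
  classical
  intro i j
  rw [← prod_map_alternatingWord]
  funext p
  rw [prod_map_signedConj]
  have hw : cs.wordProd (CoxeterSystem.alternatingWord i j (2 * m i j)) = 1 := by
    rw [CoxeterSystem.wordProd, prod_map_alternatingWord, cs.simple_mul_simple_pow]
  have hlis : cs.leftInvSeq (CoxeterSystem.alternatingWord j i (2 * m i j)) =
      (List.range (2 * m i j)).map
        fun n => cs.wordProd (CoxeterSystem.alternatingWord i j (2 * n + 1)) := by
    refine List.ext_getElem (by simp) fun n h₁ h₂ => ?_
    rw [List.getElem_map, List.getElem_range]
    exact cs.getElem_leftInvSeq_alternatingWord j i _ n (by simpa using h₁)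
  -- Reversing an alternating word of even length exchanges its two letters.
  have hrev : cs.rightInvSeq (CoxeterSystem.alternatingWord i j (2 * m i j)) =
      (cs.leftInvSeq (CoxeterSystem.alternatingWord j i (2 * m i j))).reverse := by
    rw [← cs.rightInvSeq_reverse]
    congr 1
    refine List.ext_getElem (by simp) fun n h₁ h₂ => ?_
    rw [CoxeterSystem.length_alternatingWord] at h₁
    rw [List.getElem_reverse, CoxeterSystem.getElem_alternatingWord _ _ _ _ h₁,
      CoxeterSystem.getElem_alternatingWord _ _ _ _ (by simp; omega)]
    simp only [CoxeterSystem.length_alternatingWord, Nat.even_iff]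
    split_ifs <;> first | rfl | omega
  have hper : ∀ n, cs.wordProd (CoxeterSystem.alternatingWord i j (2 * (m i j + n) + 1)) =
      cs.wordProd (CoxeterSystem.alternatingWord i j (2 * n + 1)) := by
    intro n
    rw [cs.prod_alternatingWord_eq_mul_pow, cs.prod_alternatingWord_eq_mul_pow]
    have e₁ : (2 * (m i j + n) + 1) / 2 = m i j + n := by omega
    have e₂ : (2 * n + 1) / 2 = n := by omega
    simp [e₁, e₂, pow_add, cs.simple_mul_simple_pow]
  have hcount : (((cs.rightInvSeq (CoxeterSystem.alternatingWord i j (2 * m i j))).count p.1 : ℕ)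
      : ZMod 2) = 0 := by
    rw [hrev, List.count_reverse, hlis, two_mul, List.range_add, List.map_append, List.map_map,
      List.count_append]
    simp only [Function.comp_def, hper]
    rw [Nat.cast_add]
    exact CharTwo.add_self_eq_zero _
  simp [hw, hcount, Function.End.one_def]

/-- A reflection occurring in the inversion sequence of a reduced word occurs in that of every other
word for the same element. -/
theorem mem_rightInvSeq_of_isReduced {ω ω' : List B} (hω : cs.IsReduced ω)
    (h : cs.wordProd ω = cs.wordProd ω') {t : W} (ht : t ∈ cs.rightInvSeq ω) :
    t ∈ cs.rightInvSeq ω' := by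
  classical
  have key : ∀ ω : List B, cs.lift ⟨signedConj cs, signedConj_isLiftable cs⟩ (cs.wordProd ω) =
      (ω.map (signedConj cs)).prod := by
    intro ω
    rw [CoxeterSystem.wordProd, map_list_prod, List.map_map]
    congr 2
    funext i
    exact cs.lift_apply_simple (signedConj_isLiftable cs) i
  -- Signed conjugation is an action of `W`, so the parity of the multiplicity of `t` depends only
  -- on the element. It is odd for `ω`, whose inversion sequence has no repetitions.
  have h₁ := (key ω).symm.trans ((congrArg _ h).trans (key ω'))
  have h₂ := congrArg Prod.snd (congrFun h₁ (t, 0))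
  rw [prod_map_signedConj, prod_map_signedConj] at h₂
  simp only [zero_add, List.count_eq_one_of_mem hω.nodup_rightInvSeq ht] at h₂
  by_contra hn
  rw [List.count_eq_zero_of_not_mem hn] at h₂
  simp at h₂

theorem exists_word_of_mem_parabolic {I : Set B} {w : W} (hw : w ∈ parabolic cs I) :
    ∃ ω : List B, (∀ i ∈ ω, i ∈ I) ∧ cs.wordProd ω = w := by
  induction hw using Subgroup.closure_induction with
  | mem x hx =>
    obtain ⟨i, hi, rfl⟩ := hx
    exact ⟨[i], by simpa using hi, by simp⟩
  | one => exact ⟨[], by simp, by simp⟩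
  | mul x y _ _ hx hy =>
    obtain ⟨ω, hω, rfl⟩ := hx
    obtain ⟨ω', hω', rfl⟩ := hy
    refine ⟨ω ++ ω', fun i hi => ?_, cs.wordProd_append _ _⟩
    exact (List.mem_append.1 hi).elim (hω i) (hω' i)
  | inv x _ hx =>
    obtain ⟨ω, hω, rfl⟩ := hx
    exact ⟨ω.reverse, fun i hi => hω i (List.mem_reverse.1 hi), cs.wordProd_reverse _⟩

theorem wordProd_mem {H : Subgroup W} {ω : List B} (hω : ∀ i ∈ ω, cs.simple i ∈ H) :
    cs.wordProd ω ∈ H := by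
  refine Subgroup.list_prod_mem _ fun x hx => ?_
  obtain ⟨i, hi, rfl⟩ := List.mem_map.1 hx
  exact hω i hi

theorem rightInvSeq_subset {H : Subgroup W} {ω : List B} (hω : ∀ i ∈ ω, cs.simple i ∈ H) {t : W}
    (ht : t ∈ cs.rightInvSeq ω) : t ∈ H := by
  induction ω with
  | nil => simp at ht
  | cons i ω ih =>
    have hω' : ∀ i ∈ ω, cs.simple i ∈ H := fun j hj => hω j (List.mem_cons_of_mem _ hj)
    rcases List.mem_cons.1 ht with rfl | ht
    · have := wordProd_mem cs hω'
      exact mul_mem (mul_mem (inv_mem this) (hω i List.mem_cons_self)) this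
    · exact ih hω' ht

/-- Letters are recovered from the end of the word: once the tail has product `p` in `H`, the head
`p⁻¹ s_i p` of the inversion sequence yields `s_i`. -/
theorem simple_mem_of_rightInvSeq_subset {H : Subgroup W} {ω : List B}
    (h : ∀ t ∈ cs.rightInvSeq ω, t ∈ H) : ∀ i ∈ ω, cs.simple i ∈ H := by
  induction ω with
  | nil => simp
  | cons i ω ih =>
    have hω := ih fun t ht => h t (List.mem_cons_of_mem _ ht)
    have hp := wordProd_mem cs hω
    have hi : cs.simple i ∈ H := by
      have := mul_mem (mul_mem hp (h _ List.mem_cons_self)) (inv_mem hp)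
      simpa [mul_assoc] using this
    intro j hj
    rcases List.mem_cons.1 hj with rfl | hj
    · exact hi
    · exact hω j hj

/-- The letters of a reduced word for an element of `W_I` belong to `W_I`. -/
theorem simple_mem_parabolic_of_isReduced {I : Set B} {ω : List B} (hω : cs.IsReduced ω)
    (hw : cs.wordProd ω ∈ parabolic cs I) : ∀ i ∈ ω, cs.simple i ∈ parabolic cs I := by
  obtain ⟨ω', hω', h⟩ := exists_word_of_mem_parabolic cs hw
  refine simple_mem_of_rightInvSeq_subset cs fun t ht => ?_
  refine rightInvSeq_subset cs (fun i hi => ?_) (mem_rightInvSeq_of_isReduced cs hω h.symm ht)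
  exact Subgroup.subset_closure ⟨i, hω' i hi, rfl⟩

theorem longestElement_mem {I : Set B} (hI : Finitary cs I) :
    longestElement cs I ∈ parabolic cs I :=
  (longest_spec cs (A := (parabolic cs I : Set W)) ⟨1, one_mem _⟩
    (@Set.toFinite _ _ hI)).1

theorem Finitary.mono {I J : Set B} (hJ : Finitary cs J) (h : I ⊆ J) : Finitary cs I :=
  Set.Finite.subset (s := (parabolic cs J : Set W)) (@Set.toFinite _ _ hJ)
    (Subgroup.closure_mono (Set.image_mono h))

end Inversions

/-! ### Regularity of roots and linearity of Demazure operators over invariants. -/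

/-- An element of `V` on which some functional takes the value `1` is regular in the symmetric
algebra. -/
theorem ι_mul_left_cancel {k : Type uk} {V : Type uV} [CommRing k] [AddCommGroup V] [Module k V]
    {v : V} {φ : Module.Dual k V} (hφ : φ v = 1) {x y : SymmetricAlgebra k V}
    (h : SymmetricAlgebra.ι k V v * x = SymmetricAlgebra.ι k V v * y) : x = y := by
  -- The substitution `u ↦ u + φ(u)(X - v)` sends `v` to `X`, which is regular, and is undone by
  -- evaluation at `X = v`.
  let τ : SymmetricAlgebra k V →ₐ[k] Polynomial (SymmetricAlgebra k V) :=
    SymmetricAlgebra.lift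
      ((Polynomial.CAlgHom (R := k) (A := SymmetricAlgebra k V)).toLinearMap ∘ₗ
          SymmetricAlgebra.ι k V ∘ₗ (LinearMap.id - φ.smulRight v)
        + φ.smulRight (Polynomial.X : Polynomial (SymmetricAlgebra k V)))
  have hv : τ (SymmetricAlgebra.ι k V v) = Polynomial.X := by simp [τ, hφ]
  have hτ : Function.LeftInverse (Polynomial.eval (SymmetricAlgebra.ι k V v)) τ := by
    have : ((Polynomial.aeval (SymmetricAlgebra.ι k V v)).restrictScalars k).comp τ =
        AlgHom.id k _ := by
      apply SymmetricAlgebra.algHom_ext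
      ext u
      simp [τ]
    intro z
    simpa [Polynomial.aeval_def] using DFunLike.congr_fun this z
  apply hτ.injective
  have h' := congrArg τ h
  rw [map_mul, map_mul, hv] at h'
  ext n
  simpa using congrArg (fun r => Polynomial.coeff r (n + 1)) h'

namespace Realization

variable {B : Type uB} {W : Type uW} [Group W] {m : CoxeterMatrix B} {cs : CoxeterSystem m W}
variable {k : Type uk} {V : Type uV} [CommRing k] [AddCommGroup V] [Module k V]
variable (R : Realization cs k V)

theorem act_ι (w : W) (v : V) :
    R.act w (SymmetricAlgebra.ι k V v) = SymmetricAlgebra.ι k V (R.rep w v) := by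
  simp [act]

theorem act_simple_ι (s : B) (v : V) : R.act (cs.simple s) (SymmetricAlgebra.ι k V v) =
    SymmetricAlgebra.ι k V (v - R.coroot s v • R.root s) := by
  rw [act_ι, rep_simple, reflectionMap_apply]

theorem act_one (f : R.Poly) : R.act 1 f = f := by
  have : R.act 1 = AlgHom.id k R.Poly := by
    apply SymmetricAlgebra.algHom_ext
    ext v
    simp [act_ι]
  rw [this]; rfl

theorem act_mul (w w' : W) (f : R.Poly) : R.act (w * w') f = R.act w (R.act w' f) := by
  have : R.act (w * w') = (R.act w).comp (R.act w') := by
    apply SymmetricAlgebra.algHom_ext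
    ext v
    simp [act_ι]
  rw [this]; rfl

/-- Each root takes the value `1` at some functional. -/
def RootsUnimodular : Prop := ∀ s, ∃ φ : Module.Dual k V, φ (R.root s) = 1

variable {R}

theorem RootsUnimodular.demazureSimple_mul (hR : R.RootsUnimodular) {s : B} {f : R.Poly}
    (hf : R.act (cs.simple s) f = f) (g : R.Poly) :
    R.demazureSimple s (f * g) = f * R.demazureSimple s g := by
  obtain ⟨φ, hφ⟩ := hR s
  have h : R.demazureSimple s f = 0 := by
    apply ι_mul_left_cancel hφ
    rw [root_mul_demazureSimple, hf, sub_self, mul_zero]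
  rw [R.demazureSimple_mul, hf, h, zero_mul, add_zero]

/-- Each letter of the chosen reduced word lies in `W_I` and so fixes `f`, which therefore passes
through one operator `∂_s` after another. -/
theorem RootsUnimodular.demazure_mul (hR : R.RootsUnimodular) {I : Set B} {w : W}
    (hw : w ∈ parabolic cs I) {f : R.Poly} (hf : f ∈ R.invariants I) (g : R.Poly) :
    R.demazure w (f * g) = f * R.demazure w g := by
  obtain ⟨hred, hprod⟩ := Classical.choose_spec (cs.exists_isReduced w)
  have hmem := simple_mem_parabolic_of_isReduced cs (I := I) hred (hprod ▸ hw)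
  change ∀ i ∈ reducedWord cs w, _ at hmem
  unfold demazure
  generalize reducedWord cs w = ω at hmem
  induction ω with
  | nil => simp
  | cons i ω ih =>
    rw [List.map_cons, List.prod_cons, Module.End.mul_apply, Module.End.mul_apply,
      ih fun j hj => hmem j (List.mem_cons_of_mem _ hj),
      hR.demazureSimple_mul (hf _ (hmem i List.mem_cons_self))]

theorem GeneralizedDemazureSurjective.rootsUnimodular (hR : R.GeneralizedDemazureSurjective) :
    R.RootsUnimodular := fun s => hR.root_surjective s 1

theorem invariants_mono {I M : Set B} (h : I ⊆ M) {f : R.Poly} (hf : f ∈ R.invariants M) :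
    f ∈ R.invariants I :=
  fun w hw => hf w (Subgroup.closure_mono (Set.image_mono h) hw)

end Realization

/-! ### Extension of scalars and transfer of the Leibniz rules. -/

namespace Realization

variable {B : Type uB} {W : Type uW} [Group W] {m : CoxeterMatrix B} {cs : CoxeterSystem m W}
variable {k : Type uk} {V : Type uV} [CommRing k] [AddCommGroup V] [Module k V]
variable {k' : Type uk'} {V' : Type uV'} [CommRing k'] [AddCommGroup V'] [Module k' V']
variable {R : Realization cs k V} {R' : Realization cs k' V'}

/-- The projection `f ↦ ∂_{w_J}(P f)` of `R` onto `R^J`, for an element `P` with `∂_{w_J}(P) = 1`,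
as a map of `R^M`-modules. -/
theorem GeneralizedDemazureSurjective.exists_retraction (hR : R.GeneralizedDemazureSurjective)
    {J M : Set B} (hJM : J ⊆ M) (hJ : Finitary cs J) :
    ∃ π : R.Poly →ₗ[R.invariants M] R.invariantsOver hJM,
      ∀ f : R.invariantsOver hJM, π (f : R.Poly) = f := by
  have honto := hR.onto J hJ
  have hlin := fun {f : R.Poly} (hf : f ∈ R.invariants J) =>
    hR.rootsUnimodular.demazure_mul (longestElement_mem cs hJ) hf
  obtain ⟨P, hP⟩ : (1 : R.Poly) ∈ Set.range (R.demazure (longestElement cs J)) := by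
    rw [honto]; exact one_mem _
  refine ⟨{ toFun := fun f => ⟨R.demazure (longestElement cs J) (f * P), ?_⟩
            map_add' := fun f g => ?_
            map_smul' := fun c f => ?_ }, fun f => ?_⟩
  · change _ ∈ (R.invariants J : Set R.Poly)
    rw [← honto]; exact ⟨_, rfl⟩
  · apply Subtype.ext
    change R.demazure _ _ = R.demazure _ _ + R.demazure _ _
    rw [add_mul, map_add]
  · apply Subtype.ext
    change R.demazure _ ((c : R.Poly) * f * P) = (c : R.Poly) * R.demazure _ _
    rw [mul_assoc, hlin (invariants_mono hJM c.2)]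
  · apply Subtype.ext
    change R.demazure _ ((f : R.Poly) * P) = f
    rw [hlin f.2, hP, mul_one]

/-- `R'` arises from `R` by extension of scalars along `φ`: `R'` is generated by the image of `φ`
over a subring `A` of `W`-invariants, the map `φ` is compatible with roots and reflections, and
endomorphisms of the polynomial ring that are linear over the invariants of some `M` extend
`A`-linearly. -/
structure IsScalarExtension (φ : R.Poly →+* R'.Poly) (A : Subring R'.Poly) : Prop where
  unimodular : R'.RootsUnimodular
  map_root : ∀ s, φ (SymmetricAlgebra.ι k V (R.root s)) = SymmetricAlgebra.ι k' V' (R'.root s)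
  map_act_simple : ∀ s f, φ (R.act (cs.simple s) f) = R'.act (cs.simple s) (φ f)
  act_simple_eq : ∀ s, ∀ a ∈ A, R'.act (cs.simple s) a = a
  span : ∀ x, x ∈ AddSubmonoid.closure {y | ∃ a ∈ A, ∃ f, y = a * φ f}
  extend : ∀ (M : Set B) (θ : R.Poly →ₗ[R.invariants M] R.Poly),
    ∃ θ' : R'.Poly →+ R'.Poly, ∀ a ∈ A, ∀ f, θ' (a * φ f) = a * φ (θ f)

/-- `F'` is the `A`-linear extension of `F` along `φ`. -/
def Extends (φ : R.Poly →+* R'.Poly) (A : Subring R'.Poly) (F : R.Poly → R.Poly)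
    (F' : R'.Poly → R'.Poly) : Prop :=
  ∀ a ∈ A, ∀ f, F' (a * φ f) = a * φ (F f)

namespace IsScalarExtension

variable {φ : R.Poly →+* R'.Poly} {A : Subring R'.Poly}

theorem act_eq (h : IsScalarExtension φ A) (w : W) {a : R'.Poly} (ha : a ∈ A) :
    R'.act w a = a := by
  induction w using cs.simple_induction with
  | simple i => exact h.act_simple_eq i a ha
  | one => exact R'.act_one a
  | mul w w' hw hw' => rw [act_mul, hw', hw]

theorem map_act (h : IsScalarExtension φ A) (w : W) (f : R.Poly) :
    φ (R.act w f) = R'.act w (φ f) := by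
  induction w using cs.simple_induction generalizing f with
  | simple i => exact h.map_act_simple i f
  | one => rw [act_one, act_one]
  | mul w w' hw hw' => rw [act_mul, act_mul, hw, hw']

theorem extends_act (h : IsScalarExtension φ A) (w : W) : Extends φ A (R.act w) (R'.act w) := by
  intro a ha f
  rw [map_mul, h.act_eq w ha, h.map_act]

/-- After multiplication by the regular element `α_s` both sides become differences `f - s(f)`, with
which `φ` is compatible. -/
theorem extends_demazureSimple (h : IsScalarExtension φ A) (s : B) :
    Extends φ A (R.demazureSimple s) (R'.demazureSimple s) := by
  intro a ha f
  rw [h.unimodular.demazureSimple_mul (h.act_simple_eq s a ha)]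
  congr 1
  obtain ⟨ψ, hψ⟩ := h.unimodular s
  apply ι_mul_left_cancel hψ
  rw [root_mul_demazureSimple, ← h.map_root, ← map_mul, root_mul_demazureSimple, map_sub,
    h.map_act_simple]

/-- Both operators are composed along the same reduced word, so they can be compared letter by
letter. -/
theorem extends_demazure (h : IsScalarExtension φ A) (w : W) :
    Extends φ A (R.demazure w) (R'.demazure w) := by
  unfold demazure
  induction reducedWord cs w with
  | nil => intro a _ f; simp
  | cons i ω ih =>
    intro a ha f
    simp only [List.map_cons, List.prod_cons, Module.End.mul_apply]
    rw [ih a ha, h.extends_demazureSimple i a ha]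

theorem map_mem_invariants (h : IsScalarExtension φ A) {I : Set B} {f : R.Poly}
    (hf : f ∈ R.invariants I) : φ f ∈ R'.invariants I := by
  intro w hw
  rw [← h.map_act, hf w hw]

theorem scalars_le_invariants (h : IsScalarExtension φ A) (I : Set B) {a : R'.Poly} (ha : a ∈ A) :
    a ∈ R'.invariants I := fun w _ => h.act_eq w ha

/-- The invariants of the extension are generated by the invariants. -/
theorem mem_closure_of_mem_invariants (h : IsScalarExtension φ A)
    (hR : R.GeneralizedDemazureSurjective) {J : Set B} (hJ : Finitary cs J) {x : R'.Poly}
    (hx : x ∈ R'.invariants J) :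
    x ∈ AddSubmonoid.closure {y | ∃ a ∈ A, ∃ f ∈ R.invariants J, y = a * φ f} := by
  have honto := hR.onto J hJ
  obtain ⟨P, hP⟩ : (1 : R.Poly) ∈ Set.range (R.demazure (longestElement cs J)) := by
    rw [honto]; exact one_mem _
  have hP' : R'.demazure (longestElement cs J) (φ P) = 1 := by
    have := h.extends_demazure (longestElement cs J) 1 (one_mem A) P
    simpa [hP] using this
  -- The factor `x * φ P` is a sum of terms `a * φ f`, and `∂_{w_J}` turns each into `a * φ (∂_{w_J}
  -- f)` with `∂_{w_J} f ∈ R^J`.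
  have hx' : x = R'.demazure (longestElement cs J) (x * φ P) := by
    rw [h.unimodular.demazure_mul (longestElement_mem cs hJ) hx, hP', mul_one]
  rw [hx']
  generalize x * φ P = y
  induction h.span y using AddSubmonoid.closure_induction with
  | mem y hy =>
    obtain ⟨a, ha, f, rfl⟩ := hy
    rw [h.extends_demazure _ a ha]
    refine AddSubmonoid.subset_closure ⟨a, ha, _, ?_, rfl⟩
    change _ ∈ (R.invariants J : Set R.Poly)
    rw [← honto]; exact ⟨_, rfl⟩
  | zero => rw [map_zero]; exact zero_mem _
  | add y z _ _ hy hz => rw [map_add]; exact add_mem hy hz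

/-- To prove an additive property of all invariants of the extension, it suffices to consider
multiples of images of invariants. -/
theorem invariants_induction (h : IsScalarExtension φ A) (hR : R.GeneralizedDemazureSurjective)
    {J M : Set B} (hJM : J ⊆ M) (hJ : Finitary cs J) {p : R'.invariantsOver hJM → Prop}
    (mem : ∀ a ∈ A, ∀ (f : R.invariantsOver hJM) (y : R'.invariantsOver hJM),
      (y : R'.Poly) = a * φ f → p y)
    (zero : p 0) (add : ∀ y z, p y → p z → p (y + z)) (x : R'.invariantsOver hJM) : p x := by
  obtain ⟨x, hx⟩ := x
  suffices H : ∃ hx, p ⟨x, hx⟩ from H.2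
  have hx' := h.mem_closure_of_mem_invariants hR hJ hx
  clear hx
  induction hx' using AddSubmonoid.closure_induction with
  | mem y hy =>
    obtain ⟨a, ha, f, hf, rfl⟩ := hy
    exact ⟨(R'.invariants J).mul_mem (h.scalars_le_invariants J ha) (h.map_mem_invariants hf),
      mem a ha ⟨f, hf⟩ _ rfl⟩
  | zero => exact ⟨zero_mem _, zero⟩
  | add y z _ _ hy hz => exact ⟨add_mem hy.1 hz.1, add _ _ hy.2 hz.2⟩

/-- The extension of scalars of an `R^M`-linear map `R^J → R^K`. -/
theorem exists_linearMap (h : IsScalarExtension φ A) (hR : R.GeneralizedDemazureSurjective)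
    {J K M : Set B} (hJM : J ⊆ M) (hKM : K ⊆ M) (hM : Finitary cs M)
    (T : R.invariantsOver hJM →ₗ[R.invariants M] R.invariantsOver hKM) :
    ∃ T' : R'.invariantsOver hJM →ₗ[R'.invariants M] R'.invariantsOver hKM,
      ∀ a ∈ A, ∀ (f : R.invariantsOver hJM) (x : R'.invariantsOver hJM),
        (x : R'.Poly) = a * φ f → (T' x : R'.Poly) = a * φ (T f) := by
  obtain ⟨π, hπ⟩ := hR.exists_retraction hJM (hM.mono cs hJM)
  -- `T` is only defined on `R^J`; the retraction `π` makes it an endomorphism of `R`, which agrees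
  -- with `T` on `R^J`.
  obtain ⟨θ', hθ'⟩ := h.extend M ((R.invariantsOver hKM).subtype ∘ₗ T ∘ₗ π)
  have hθ : ∀ a ∈ A, ∀ f : R.invariantsOver hJM, θ' (a * φ f) = a * φ (T f) := by
    intro a ha f
    rw [hθ' a ha]
    simp [hπ]
  have hJ := hM.mono cs hJM
  have hmem : ∀ x : R'.invariantsOver hJM, θ' x ∈ R'.invariants K := by
    refine h.invariants_induction hR hJM hJ (fun a ha f y hy => ?_) ?_ fun y z hy hz => ?_
    · rw [hy, hθ a ha]
      exact mul_mem (h.scalars_le_invariants K ha) (h.map_mem_invariants (T f).2)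
    · rw [Submodule.coe_zero, map_zero]; exact zero_mem _
    · rw [Submodule.coe_add, map_add]; exact add_mem hy hz
  -- The scalar `c ∈ R'^M` is regarded as an element of `invariantsOver` so that the same induction
  -- applies to it; on generators the claim is the `R^M`-linearity of `T`.
  have hmul : ∀ (c : R'.invariantsOver (subset_refl M)) (x : R'.invariantsOver hJM),
      θ' ((c : R'.Poly) * x) = c * θ' x := by
    refine h.invariants_induction hR _ hM (fun a ha r c hc => ?_) ?_ fun c d hc hd x => ?_
    · refine h.invariants_induction hR hJM hJ (fun b hb f y hy => ?_) ?_ fun y z hy hz => ?_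
      · have hrf : (T ⟨r * f, (R.invariantsOver hJM).smul_mem ⟨r, r.2⟩ f.2⟩ : R.Poly) = r * T f :=
          congrArg Subtype.val (T.map_smul ⟨r, r.2⟩ f)
        have e : (c : R'.Poly) * y = a * b * φ (r * f : R.Poly) := by
          rw [hc, hy, map_mul]; ring
        rw [e, hθ _ (mul_mem ha hb) ⟨r * f, (R.invariantsOver hJM).smul_mem ⟨r, r.2⟩ f.2⟩, hrf, hy,
          hc, hθ b hb, map_mul]
        ring
      · simp
      · rw [Submodule.coe_add, mul_add, map_add, map_add, hy, hz, mul_add]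
    · simp
    · rw [Submodule.coe_add, add_mul, map_add, hc, hd, add_mul]
  refine ⟨{ toFun := fun x => ⟨θ' x, hmem x⟩
            map_add' := fun x y => Subtype.ext (map_add θ' (x : R'.Poly) y)
            map_smul' := fun c x => Subtype.ext (hmul ⟨c, c.2⟩ x) }, ?_⟩
  intro a ha f x hx
  change θ' x = _
  rw [hx, hθ a ha]

/-- A Leibniz rule `D(f g) = x(f) D(g) + ∑ E_q(T_q(f) F_q(g))` is preserved by extension of
scalars. -/
theorem leibniz (h : IsScalarExtension φ A) (hR : R.GeneralizedDemazureSurjective)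
    {Q : Type*} [Finite Q] {J M : Set B} (hJM : J ⊆ M) {K : Q → Set B} (hKM : ∀ q, K q ⊆ M)
    (hM : Finitary cs M) (x : W) {D : Module.End k R.Poly} {D' : Module.End k' R'.Poly}
    {E F : Q → Module.End k R.Poly} {E' F' : Q → Module.End k' R'.Poly} (hD : Extends φ A D D')
    (hE : ∀ q, Extends φ A (E q) (E' q)) (hF : ∀ q, Extends φ A (F q) (F' q))
    (hT : ∃ T : ∀ q, R.invariantsOver hJM →ₗ[R.invariants M] R.invariantsOver (hKM q),
      ∀ f g : R.invariantsOver hJM, D (f * g : R.Poly) =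
        R.act x (f : R.Poly) * D (g : R.Poly) + ∑ᶠ q, E q ((T q f : R.Poly) * F q (g : R.Poly))) :
    ∃ T : ∀ q, R'.invariantsOver hJM →ₗ[R'.invariants M] R'.invariantsOver (hKM q),
      ∀ f g : R'.invariantsOver hJM, D' (f * g : R'.Poly) =
        R'.act x (f : R'.Poly) * D' (g : R'.Poly) +
          ∑ᶠ q, E' q ((T q f : R'.Poly) * F' q (g : R'.Poly)) := by
  obtain ⟨T, hT⟩ := hT
  choose T' hT' using fun q => h.exists_linearMap hR hJM (hKM q) hM (T q)
  refine ⟨T', ?_⟩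
  have := Fintype.ofFinite Q
  simp only [finsum_eq_sum_of_fintype] at hT ⊢
  have hJ := hM.mono cs hJM
  -- By biadditivity both arguments may be taken to be generators, and then `a * b` comes out of
  -- every term.
  refine h.invariants_induction hR hJM hJ (fun a ha f y hy => ?_) ?_ fun y y' hy hy' z => ?_
  · refine h.invariants_induction hR hJM hJ (fun b hb g z hz => ?_) ?_ fun z z' hz hz' => ?_
    · have e : a * φ f * (b * φ g) = a * b * φ (f * g : R.Poly) := by rw [map_mul]; ring
      have hsum : ∀ q, E' q ((T' q y : R'.Poly) * F' q (z : R'.Poly)) =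
          a * b * φ (E q ((T q f : R.Poly) * F q (g : R.Poly))) := by
        intro q
        rw [hT' q a ha f y hy, hz, hF q b hb, ← hE q _ (mul_mem ha hb), φ.map_mul]
        congr 1; ring
      simp only [hsum]
      rw [hy, hz, e, hD _ (mul_mem ha hb), hT, hD b hb, h.extends_act x a ha, map_add, map_mul,
        map_sum, mul_add, Finset.mul_sum]
      congr 1; ring
    · simp
    · simp only [Submodule.coe_add, mul_add, map_add, hz, hz', Finset.sum_add_distrib]
      ring
  · simp
  · simp only [Submodule.coe_add, add_mul, map_add, hy, hy', Finset.sum_add_distrib]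
    ring

/-- The inner operators `F q` are the identity here; in the leftward rule they are the Demazure
operators of the cores. -/
theorem rightwardRule (h : IsScalarExtension φ A) (hR : R.GeneralizedDemazureSurjective)
    (d : AtomicDatum cs) (hd : R.RightwardRule d) : R'.RightwardRule d :=
  h.leibniz hR d.J_subset (fun q : {q : Coset cs d.I d.J // q.Lt d.coset} => d.rightRed_subset q.1)
    d.finitary d.coset.min (h.extends_demazure _) (fun _ => h.extends_demazure _)
    (F := fun _ => 1) (F' := fun _ => 1) (fun _ _ _ _ => rfl) hd

theorem leftwardRule (h : IsScalarExtension φ A) (hR : R.GeneralizedDemazureSurjective)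
    (d : AtomicDatum cs) (hd : R.LeftwardRule d) : R'.LeftwardRule d :=
  h.leibniz hR d.J_subset (fun q : {q : Coset cs d.I d.J // q.Lt d.coset} => d.leftRed_subset q.1)
    d.finitary d.coset.min (h.extends_demazure _) (fun _ => h.extends_demazure _)
    (fun _ => h.extends_demazure _) hd

end IsScalarExtension

end Realization

namespace Realization

variable {B : Type uB} {W : Type uW} [Group W] {m : CoxeterMatrix B} {cs : CoxeterSystem m W}
variable {k : Type uk} {V : Type uV} [CommRing k] [AddCommGroup V] [Module k V]
variable {R : Realization cs k V}

open SymmetricAlgebra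

/-! ### Specializations: `A` is the image of `k'`, and endomorphisms extend as `id ⊗ θ`. -/

section Specialization

variable (k V) (k' : Type uk') [CommRing k'] [Algebra k k']

/-- The map `Sym_k(V) → Sym_{k'}(k' ⊗ V)`. -/
def baseChangeMap : SymmetricAlgebra k V →ₐ[k] SymmetricAlgebra k' (k' ⊗[k] V) :=
  lift ((ι k' (k' ⊗[k] V)).restrictScalars k ∘ₗ TensorProduct.mk k k' V 1)

theorem baseChangeMap_ι (v : V) : baseChangeMap k V k' (ι k V v) = ι k' (k' ⊗[k] V) (1 ⊗ₜ v) := by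
  simp [baseChangeMap]

/-- The map `k' ⊗ Sym_k(V) → Sym_{k'}(k' ⊗ V)`. -/
def ofBaseChange : k' ⊗[k] SymmetricAlgebra k V →ₐ[k'] SymmetricAlgebra k' (k' ⊗[k] V) :=
  Algebra.TensorProduct.lift (Algebra.ofId k' _) (baseChangeMap k V k') fun _ _ => .all _ _

/-- The map `Sym_{k'}(k' ⊗ V) → k' ⊗ Sym_k(V)`. -/
def toBaseChange : SymmetricAlgebra k' (k' ⊗[k] V) →ₐ[k'] k' ⊗[k] SymmetricAlgebra k V :=
  lift ((ι k V).baseChange k')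

theorem ofBaseChange_toBaseChange (x : SymmetricAlgebra k' (k' ⊗[k] V)) :
    ofBaseChange k V k' (toBaseChange k V k' x) = x := by
  have : (ofBaseChange k V k').comp (toBaseChange k V k') = AlgHom.id k' _ := by
    apply SymmetricAlgebra.algHom_ext
    ext v
    simp [ofBaseChange, toBaseChange, baseChangeMap_ι]
  exact DFunLike.congr_fun this x

theorem toBaseChange_ofBaseChange (x : k' ⊗[k] SymmetricAlgebra k V) :
    toBaseChange k V k' (ofBaseChange k V k' x) = x := by
  have : (toBaseChange k V k').comp (ofBaseChange k V k') = AlgHom.id k' _ := by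
    apply Algebra.TensorProduct.ext
    · ext
    · apply SymmetricAlgebra.algHom_ext
      ext v
      simp [ofBaseChange, toBaseChange, baseChangeMap_ι]
  exact DFunLike.congr_fun this x

theorem ofBaseChange_tmul (a : k') (f : SymmetricAlgebra k V) :
    ofBaseChange k V k' (a ⊗ₜ f) = algebraMap k' _ a * baseChangeMap k V k' f := by
  simp [ofBaseChange, Algebra.ofId_apply]

variable {k V}

theorem isScalarExtension_specialization (hR : R.RootsUnimodular) :
    IsScalarExtension (R := R) (R' := R.specialization k') (baseChangeMap k V k').toRingHom
      (algebraMap k' (SymmetricAlgebra k' (k' ⊗[k] V))).range where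
  unimodular s := by
    obtain ⟨φ, hφ⟩ := hR s
    exact ⟨φ.baseChange k', by simp [specialization, hφ]⟩
  map_root s := baseChangeMap_ι k V k' _
  map_act_simple s f := by
    have : (baseChangeMap k V k').comp (R.act (cs.simple s)) =
        (((R.specialization k').act (cs.simple s)).restrictScalars k).comp
          (baseChangeMap k V k') := by
      apply SymmetricAlgebra.algHom_ext
      ext v
      simp [act_simple_ι, baseChangeMap_ι, specialization]
    exact DFunLike.congr_fun this f
  act_simple_eq s := by
    rintro _ ⟨a, rfl⟩
    exact ((R.specialization k').act (cs.simple s)).commutes a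
  span x := by
    rw [← ofBaseChange_toBaseChange k V k' x]
    induction toBaseChange k V k' x using TensorProduct.induction_on with
    | zero => rw [map_zero]; exact zero_mem _
    | add y z hy hz => rw [map_add]; exact add_mem hy hz
    | tmul a f =>
      exact AddSubmonoid.subset_closure ⟨_, ⟨a, rfl⟩, f, ofBaseChange_tmul k V k' a f⟩
  extend M θ := by
    refine ⟨((ofBaseChange k V k').toLinearMap ∘ₗ (θ.restrictScalars k).baseChange k' ∘ₗ
      (toBaseChange k V k').toLinearMap).toAddMonoidHom, ?_⟩
    rintro _ ⟨a, rfl⟩ f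
    change ofBaseChange k V k' ((θ.restrictScalars k).baseChange k'
      (toBaseChange k V k' (algebraMap k' _ a * baseChangeMap k V k' f))) =
        algebraMap k' _ a * baseChangeMap k V k' (θ f)
    rw [← ofBaseChange_tmul, toBaseChange_ofBaseChange, LinearMap.baseChange_tmul,
      ofBaseChange_tmul]
    rfl

end Specialization

/-! ### Enlargements: `A` is the image of `Sym(N)`, and endomorphisms extend as `id ⊗ θ`. -/

section Enlargement

variable (k V) (N : Type uN) [AddCommGroup N] [Module k N]

/-- The map `Sym(V) → Sym(V ⊕ N)`. -/
def inlMap : SymmetricAlgebra k V →ₐ[k] SymmetricAlgebra k (V × N) :=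
  lift (ι k (V × N) ∘ₗ LinearMap.inl k V N)

/-- The map `Sym(N) → Sym(V ⊕ N)`. -/
def inrMap : SymmetricAlgebra k N →ₐ[k] SymmetricAlgebra k (V × N) :=
  lift (ι k (V × N) ∘ₗ LinearMap.inr k V N)

/-- The map `Sym(N) ⊗ Sym(V) → Sym(V ⊕ N)`. -/
def ofTensor : SymmetricAlgebra k N ⊗[k] SymmetricAlgebra k V →ₐ[k] SymmetricAlgebra k (V × N) :=
  Algebra.TensorProduct.productMap (inrMap k V N) (inlMap k V N)

/-- The map `Sym(V ⊕ N) → Sym(N) ⊗ Sym(V)`. -/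
def toTensor : SymmetricAlgebra k (V × N) →ₐ[k] SymmetricAlgebra k N ⊗[k] SymmetricAlgebra k V :=
  lift (LinearMap.coprod
    (Algebra.TensorProduct.includeRight.toLinearMap ∘ₗ ι k V)
    (Algebra.TensorProduct.includeLeft.toLinearMap ∘ₗ ι k N))

theorem ofTensor_toTensor (x : SymmetricAlgebra k (V × N)) :
    ofTensor k V N (toTensor k V N x) = x := by
  have : (ofTensor k V N).comp (toTensor k V N) = AlgHom.id k _ := by
    apply SymmetricAlgebra.algHom_ext
    ext v <;> simp [ofTensor, toTensor, inlMap, inrMap]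
  exact DFunLike.congr_fun this x

theorem toTensor_ofTensor (x : SymmetricAlgebra k N ⊗[k] SymmetricAlgebra k V) :
    toTensor k V N (ofTensor k V N x) = x := by
  have : (toTensor k V N).comp (ofTensor k V N) = AlgHom.id k _ := by
    apply Algebra.TensorProduct.ext <;> apply SymmetricAlgebra.algHom_ext <;> ext v <;>
      simp [ofTensor, toTensor, inlMap, inrMap]
  exact DFunLike.congr_fun this x

theorem ofTensor_tmul (a : SymmetricAlgebra k N) (f : SymmetricAlgebra k V) :
    ofTensor k V N (a ⊗ₜ f) = inrMap k V N a * inlMap k V N f := by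
  simp [ofTensor]

variable {k V}

theorem isScalarExtension_enlargement [Module.Free k N] [Module.Finite k N]
    (hR : R.RootsUnimodular) :
    IsScalarExtension (R := R) (R' := R.enlargement N) (inlMap k V N).toRingHom
      (inrMap k V N).toRingHom.range where
  unimodular s := by
    obtain ⟨φ, hφ⟩ := hR s
    exact ⟨φ ∘ₗ LinearMap.fst k V N, by simp [enlargement, hφ]⟩
  map_root s := by simp [inlMap, enlargement]
  map_act_simple s f := by
    have : (inlMap k V N).comp (R.act (cs.simple s)) =
        ((R.enlargement N).act (cs.simple s)).comp (inlMap k V N) := by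
      apply SymmetricAlgebra.algHom_ext
      ext v
      simp [act_simple_ι, inlMap, enlargement, -map_sub]
    exact DFunLike.congr_fun this f
  act_simple_eq s := by
    rintro _ ⟨a, rfl⟩
    have : ((R.enlargement N).act (cs.simple s)).comp (inrMap k V N) = inrMap k V N := by
      apply SymmetricAlgebra.algHom_ext
      ext v
      simp [act_simple_ι, inrMap, enlargement]
    exact DFunLike.congr_fun this a
  span x := by
    rw [← ofTensor_toTensor k V N x]
    induction toTensor k V N x using TensorProduct.induction_on with
    | zero => rw [map_zero]; exact zero_mem _
    | add y z hy hz => rw [map_add]; exact add_mem hy hz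
    | tmul a f => exact AddSubmonoid.subset_closure ⟨_, ⟨a, rfl⟩, f, ofTensor_tmul k V N a f⟩
  extend M θ := by
    refine ⟨((ofTensor k V N).toLinearMap ∘ₗ (θ.restrictScalars k).lTensor _ ∘ₗ
      (toTensor k V N).toLinearMap).toAddMonoidHom, ?_⟩
    rintro _ ⟨a, rfl⟩ f
    change ofTensor k V N ((θ.restrictScalars k).lTensor _
      (toTensor k V N (inrMap k V N a * inlMap k V N f))) = inrMap k V N a * inlMap k V N (θ f)
    rw [← ofTensor_tmul, toTensor_ofTensor, LinearMap.lTensor_tmul, ofTensor_tmul]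
    rfl

end Enlargement

/-! ### Quotients: `φ` is surjective, and endomorphisms descend through a section. -/

section Quotient

/-- The map `Sym(V) → Sym(Y)` induced by the projection. -/
def QuotientDatum.polyProj (D : R.QuotientDatum) :
    SymmetricAlgebra k V →ₐ[k] SymmetricAlgebra k D.Y :=
  lift (ι k D.Y ∘ₗ D.proj)

/-- The section `Sym(Y) → Sym(V)` of the projection. -/
def QuotientDatum.polySection (D : R.QuotientDatum) :
    SymmetricAlgebra k D.Y →ₐ[k] SymmetricAlgebra k V :=
  lift (ι k V ∘ₗ D.Y.subtype)

theorem QuotientDatum.proj_coe (D : R.QuotientDatum) (y : D.Y) : D.proj (y : V) = y :=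
  Submodule.projectionOnto_apply_left D.isCompl.symm y

theorem QuotientDatum.polyProj_polySection (D : R.QuotientDatum) (f : SymmetricAlgebra k D.Y) :
    D.polyProj (D.polySection f) = f := by
  have : D.polyProj.comp D.polySection = AlgHom.id k _ := by
    apply SymmetricAlgebra.algHom_ext
    ext v
    simp [polyProj, polySection, D.proj_coe]
  exact DFunLike.congr_fun this f

theorem QuotientDatum.sub_polySection_mem (D : R.QuotientDatum) (f : SymmetricAlgebra k V) :
    f - D.polySection (D.polyProj f) ∈ Ideal.span (ι k V '' D.X) := by
  induction f using SymmetricAlgebra.induction with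
  | algebraMap r => simp
  | ι v =>
    refine Ideal.subset_span ⟨v - (D.proj v : V), ?_, by simp [polyProj, polySection]⟩
    refine (Submodule.projectionOnto_apply_eq_zero_iff D.isCompl.symm).1 ?_
    change D.proj _ = 0
    rw [map_sub, D.proj_coe, sub_self]
  | mul a b ha hb =>
    rw [map_mul, map_mul]
    convert add_mem (Ideal.mul_mem_right b _ ha)
      (Ideal.mul_mem_left _ (D.polySection (D.polyProj a)) hb) using 1
    ring
  | add a b ha hb =>
    rw [map_add, map_add]
    convert add_mem ha hb using 1
    ring

theorem QuotientDatum.ι_mem_invariants (D : R.QuotientDatum) {x : V} (hx : x ∈ D.X) (M : Set B) :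
    ι k V x ∈ R.invariants M := fun w _ => by rw [act_ι, D.trivial w x hx]

/-- Since `W` fixes `X`, its elements are scalars for `θ`, which therefore preserves the ideal they
generate. This makes `polyProj ∘ θ` descend to `Sym(Y)`. -/
theorem QuotientDatum.polyProj_map_eq_zero (D : R.QuotientDatum) {M : Set B}
    (θ : R.Poly →ₗ[R.invariants M] R.Poly) {f : R.Poly} (hf : f ∈ Ideal.span (ι k V '' D.X)) :
    D.polyProj (θ f) = 0 := by
  -- `θ` is not linear over the whole polynomial ring, so the induction over the ideal has to carry
  -- all multiples of `f`.
  suffices H : ∀ c : R.Poly, D.polyProj (θ (c * f)) = 0 by simpa using H 1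
  induction hf using Submodule.span_induction with
  | zero => simp
  | add f g _ _ hf hg => intro c; rw [mul_add, map_add, map_add, hf, hg, add_zero]
  | mem f hf =>
    obtain ⟨x, hx, rfl⟩ := hf
    intro c
    have h : θ (ι k V x * c) = ι k V x * θ c := θ.map_smul ⟨_, D.ι_mem_invariants hx M⟩ c
    have hx' : D.proj x = 0 := (Submodule.projectionOnto_apply_eq_zero_iff D.isCompl.symm).2 hx
    rw [mul_comm, h, map_mul]
    simp [polyProj, hx']
  | smul c f _ hf => intro c'; rw [smul_eq_mul, ← mul_assoc]; exact hf _

theorem QuotientDatum.isScalarExtension (D : R.QuotientDatum) :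
    IsScalarExtension (R := R) (R' := Realization.quotient D) D.polyProj.toRingHom
      (algebraMap k (SymmetricAlgebra k D.Y)).range where
  unimodular s := D.surjective s 1
  map_root s := by simp [polyProj, Realization.quotient]
  map_act_simple s f := by
    have : D.polyProj.comp (R.act (cs.simple s)) =
        ((Realization.quotient D).act (cs.simple s)).comp D.polyProj := by
      apply SymmetricAlgebra.algHom_ext
      ext v
      simp [act_simple_ι, polyProj, Realization.quotient, D.coroot_proj]
    exact DFunLike.congr_fun this f
  act_simple_eq s := by
    rintro _ ⟨a, rfl⟩
    exact ((Realization.quotient D).act (cs.simple s)).commutes a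
  span x := by
    refine AddSubmonoid.subset_closure ⟨1, one_mem _, D.polySection x, ?_⟩
    rw [one_mul]
    exact (D.polyProj_polySection x).symm
  extend M θ := by
    refine ⟨(D.polyProj.toLinearMap ∘ₗ θ.restrictScalars k ∘ₗ
      D.polySection.toLinearMap).toAddMonoidHom, ?_⟩
    rintro _ ⟨a, rfl⟩ f
    change D.polyProj (θ.restrictScalars k (D.polySection (algebraMap k _ a * D.polyProj f))) =
      algebraMap k _ a * D.polyProj (θ.restrictScalars k f)
    rw [← Algebra.smul_def, ← Algebra.smul_def, map_smul, map_smul, map_smul]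
    congr 1
    have := D.polyProj_map_eq_zero θ (D.sub_polySection_mem f)
    rw [map_sub, map_sub, sub_eq_zero] at this
    exact this.symm

end Quotient

end Realization

end AtomicLeibniz

end

theorem mainTheorem8
    {B : Type uB} {W : Type uW} [Group W] {m : CoxeterMatrix B} (cs : CoxeterSystem m W)
    {k : Type uk} {V : Type uV} [CommRing k] [AddCommGroup V] [Module k V]
    (R : AtomicLeibniz.Realization cs k V) (hR : R.IsFrobenius) (d : AtomicLeibniz.AtomicDatum cs) :
    (R.RightwardRule d →
      (∀ (k' : Type uk') [CommRing k'] [Algebra k k'], (R.specialization k').RightwardRule d) ∧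
      (∀ (N : Type uN) [AddCommGroup N] [Module k N] [Module.Free k N] [Module.Finite k N],
        (R.enlargement N).RightwardRule d) ∧
      (∀ D : R.QuotientDatum, (AtomicLeibniz.Realization.quotient D).RightwardRule d)) ∧
    (R.LeftwardRule d →
      (∀ (k' : Type uk') [CommRing k'] [Algebra k k'], (R.specialization k').LeftwardRule d) ∧
      (∀ (N : Type uN) [AddCommGroup N] [Module k N] [Module.Free k N] [Module.Finite k N],
        (R.enlargement N).LeftwardRule d) ∧
      (∀ D : R.QuotientDatum, (AtomicLeibniz.Realization.quotient D).LeftwardRule d)) := by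
  have hS := hR.surjective
  have hU := hS.rootsUnimodular
  refine ⟨fun h => ⟨fun k' _ _ => ?_, fun N _ _ _ _ => ?_, fun D => ?_⟩,
    fun h => ⟨fun k' _ _ => ?_, fun N _ _ _ _ => ?_, fun D => ?_⟩⟩
  · exact (AtomicLeibniz.Realization.isScalarExtension_specialization k' hU).rightwardRule hS d h
  · exact (AtomicLeibniz.Realization.isScalarExtension_enlargement N hU).rightwardRule hS d h
  · exact D.isScalarExtension.rightwardRule hS d h
  · exact (AtomicLeibniz.Realization.isScalarExtension_specialization k' hU).leftwardRule hS d h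
  · exact (AtomicLeibniz.Realization.isScalarExtension_enlargement N hU).leftwardRule hS d h
  · exact D.isScalarExtension.leftwardRule hS d h
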